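/- An instance of Resolve Delegation consists of a finite directed graph $\mathcal G=(\mathcal V,\mathcal E)$ without loops (the delegation graph) and an integer $\lambda$. A sink is a vertex of $\mathcal G$ without outgoing edges; let $\mathcal T\subseteq\mathcal V$ be the set of sinks. The question is whether $\mathcal G$ has an acyclic spanning subgraph $\mathcal H$ such that (i) every vertex in $\mathcal V\setminus\mathcal T$ has out-degree exactly $1$ in $\mathcal H$, and (ii) for every sink $t\in\mathcal T$, the number of vertices (including $t$) that have a directed path to $t$ in $\mathcal H$ is at most $\lambda$. Theorem. Resolve Delegation is fixed-parameter tractable when parameterized by the number $k=|\mathcal V\setminus\mathcal T|$ of non-sink vertices: there are an algorithm (a program for a random access machine with addition and subtraction, charged one unit per executed instruction), a computable function $f$ and a constant $c$ such that the algorithm decides every instance $(\mathcal G,\lambda)$, with $n=|\mathcal V|$ vertices, within $f(k)\cdot(n+1)^{c}$ steps. The same holds for the variant of the problem in which $\mathcal H$ is not required to be acyclic. -/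

import Mathlib

/-! ## Random access machines with a step count

A machine has registers `X₀, X₁, X₂, …` holding natural numbers, all initially `0`, and a read-only
input, which is a list of natural numbers. A program is a finite list of instructions. Every
executed instruction counts as one step. As the only arithmetic is addition and (truncated)
subtraction, this model is polynomially equivalent to Turing machines. -/

namespace RAM

/-- The instructions of the machine. -/
inductive Instr where
  /-- `Xᵢ := c` -/
  | const (i c : ℕ)
  /-- `Xᵢ := Xⱼ + Xₖ` -/
  | add (i j k : ℕ)
  /-- `Xᵢ := max (Xⱼ - Xₖ) 0` -/
  | sub (i j k : ℕ)
  /-- `Xᵢ := X_a` where `a = Xⱼ` (indirect addressing) -/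
  | load (i j : ℕ)
  /-- `X_a := Xⱼ` where `a = Xᵢ` (indirect addressing) -/
  | store (i j : ℕ)
  /-- `Xᵢ :=` the input entry with index `Xⱼ` (counted from `0`; the value is `0` beyond the end) -/
  | read (i j : ℕ)
  /-- if `Xⱼ = 0`, continue with instruction number `l` -/
  | jumpZero (j l : ℕ)

/-- A program is a finite list of instructions, numbered from `0`. -/
abbrev Program := List Instr

/-- A configuration: the program counter and the contents of the registers. -/
structure Config where
  pc : ℕ
  reg : ℕ → ℕ

/-- The initial configuration. -/
def initial : Config := ⟨0, fun _ => 0⟩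

/-- Write the value `v` to the register `i` and go on to the next instruction. -/
def Config.write (s : Config) (i v : ℕ) : Config :=
  ⟨s.pc + 1, Function.update s.reg i v⟩

/-- Execution of a single instruction. -/
def Instr.exec (input : List ℕ) (s : Config) : Instr → Config
  | .const i c => s.write i c
  | .add i j k => s.write i (s.reg j + s.reg k)
  | .sub i j k => s.write i (s.reg j - s.reg k)
  | .load i j => s.write i (s.reg (s.reg j))
  | .store i j => s.write (s.reg i) (s.reg j)
  | .read i j => s.write i (input.getD (s.reg j) 0)
  | .jumpZero j l => ⟨if s.reg j = 0 then l else s.pc + 1, s.reg⟩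

/-- One step of the program `P`. A configuration whose program counter points outside of the
program is halted, and does not change any more. -/
def step (P : Program) (input : List ℕ) (s : Config) : Config :=
  match P[s.pc]? with
  | none => s
  | some I => I.exec input s

/-- On the given input, the program `P` halts after at most `T` steps, with `out` in the
register `X₀`. -/
def HaltsWithin (P : Program) (input : List ℕ) (T out : ℕ) : Prop :=
  ∃ t ≤ T, P.length ≤ ((step P input)^[t] initial).pc ∧
    ((step P input)^[t] initial).reg 0 = out

end RAM

/-- Fixed-parameter tractability of a parameterized decision problem with instances in `α`,
yes-instances `yes`, parameter `param`, where an instance `x` has size `size x` and is presented to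
the machine as `encode x`: a single program decides the problem, with output `1` on yes-instances
and `0` on no-instances, within `f (param x) * (size x + 1) ^ c` steps, for a computable function
`f` and a constant `c`. For Resolve Delegation the size is the number of vertices, which is smaller
than the length of the encoding, so that the bound is at least as strong as one in that length. -/
def FixedParameterTractable {α : Type} (encode : α → List ℕ) (size param : α → ℕ)
    (yes : α → Prop) : Prop :=
  ∃ (P : RAM.Program) (f : ℕ → ℕ) (c : ℕ), Computable f ∧
    ∀ x : α,
      (yes x → RAM.HaltsWithin P (encode x) (f (param x) * (size x + 1) ^ c) 1) ∧
      (¬ yes x → RAM.HaltsWithin P (encode x) (f (param x) * (size x + 1) ^ c) 0)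

/-! ## Resolving delegations -/

namespace Delegation

/-- A sink is a vertex without outgoing edges. -/
def IsSink {V : Type} (G : Digraph V) (v : V) : Prop :=
  ∀ w, ¬ G.Adj v w

/-- The number of vertices (including `t`) that have a directed path to `t` in `H`. -/
noncomputable def weight {V : Type} (H : Digraph V) (t : V) : ℕ :=
  {u | Relation.ReflTransGen H.Adj u t}.ncard

/-- `H` is a spanning subgraph of the delegation graph `G` in which every non-sink of `G` has
exactly one outgoing edge, and every sink `t` of `G` is reached by at most `lam` vertices. -/
structure IsSolution {V : Type} (G : Digraph V) (lam : ℤ) (H : Digraph V) : Prop where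
  subgraph : H ≤ G
  outdegree : ∀ v, ¬ IsSink G v → ∃! w, H.Adj v w
  weight_le : ∀ t, IsSink G t → (weight H t : ℤ) ≤ lam

/-- `H` has no directed cycle. -/
def Acyclic {V : Type} (H : Digraph V) : Prop :=
  ∀ v, ¬ Relation.TransGen H.Adj v v

/-- An instance `(G, λ)`: a finite directed graph without loops and an integer. The vertices are
numbered `0, …, n - 1`. -/
structure Instance where
  n : ℕ
  graph : Digraph (Fin n)
  loopless : ∀ v, ¬ graph.Adj v v
  lam : ℤ

/-- The number of vertices. -/
def Instance.size (x : Instance) : ℕ := x.n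

/-- The number of non-sink vertices. -/
noncomputable def Instance.nonSinks (x : Instance) : ℕ :=
  {v | ¬ IsSink x.graph v}.ncard

/-- The input to the machine: the number `n` of vertices, the integer `λ` (as the two numbers
`max λ 0` and `max (-λ) 0`), and then the `n * n` entries of the adjacency matrix, row by row. -/
noncomputable def Instance.encode (x : Instance) : List ℕ :=
  x.n :: x.lam.toNat :: (-x.lam).toNat ::
    (List.finRange x.n).flatMap fun u =>
      (List.finRange x.n).map fun v =>
        haveI := Classical.propDecidable (x.graph.Adj u v)
        if x.graph.Adj u v then 1 else 0

/-- Resolve Delegation: is there an acyclic solution? -/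
def Instance.Resolvable (x : Instance) : Prop :=
  ∃ H, IsSolution x.graph x.lam H ∧ Acyclic H

/-- The variant in which the solution may contain directed cycles among the non-sinks. -/
def Instance.ResolvableWithCycles (x : Instance) : Prop :=
  ∃ H, IsSolution x.graph x.lam H

end Delegation

/-!
The algorithm is exhaustive search over a small set of candidate solutions. A solution `H` is the
same as a map `g` that fixes every sink and sends every non-sink to an out-neighbour
(`choiceGraph`). By the pigeonhole principle a walk along `g` that reaches a sink does so within
`n` steps, so the weight of a sink `t` is the number of `v` with `g^[n] v = t`, and `H` is acyclic
exactly if every `g^[n] v` is a sink (`exists_isSolution_iff`).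

There are up to `n ^ k` such maps, which is too many, but sinks with the same in-neighbours (twins)
are interchangeable. Call a sink kept if fewer than `k` of its twins have a smaller number. As `g`
uses at most `k` sinks, whenever it uses a sink that is not kept there is an unused smaller twin.
Swapping the two is an automorphism of the graph, hence turns `g` into another solution, and it
decreases `∑ v, g v`. So some solution sends non-sinks to non-sinks and kept sinks only
(`IsGoodChoice.exists_kept`). There are at most `m ≤ k + k * 2 ^ k` vertices of these two kinds, as
a kept sink is determined by its set of in-neighbours and its rank among its twins
(`ncard_kept_le`). It remains to try `m ^ k` maps, which are encoded as the numbers `c < m ^ k`: the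
digits of `c` in base `m` are the values of the map (`exists_targetFin_eq`).

Because a factor that depends on `k` alone is free, the search needs no data structures at all.
It is written as an expression in a small language `RAM.LoopExpr` of arithmetic expressions with
bounded loops. The language is compiled to the machine once and for all, and an evaluation in which
no loop makes more than `B` passes takes a number of steps that is polynomial in `B`
(`RAM.Computes`, `RAM.LoopExpr.bound_le`). Every loop of the search is bounded by `n` or by `m ^ k`,
which yields the running time.
-/

/-! ### Expressions with bounded loops and their compilation -/

namespace RAM

/-- Arithmetic expressions with bounded loops in `n` variables, with values in `ℕ`. Subtraction is
truncated, and `read e` is the input entry with index `e`. -/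
inductive LoopExpr : ℕ → Type where
  | const {n : ℕ} (c : ℕ) : LoopExpr n
  | var {n : ℕ} (i : Fin n) : LoopExpr n
  | add {n : ℕ} (e f : LoopExpr n) : LoopExpr n
  | sub {n : ℕ} (e f : LoopExpr n) : LoopExpr n
  | read {n : ℕ} (e : LoopExpr n) : LoopExpr n
  /-- `let x := e; f`, where `x` is variable `0` of `f` and the others are shifted by one -/
  | bind {n : ℕ} (e : LoopExpr n) (f : LoopExpr (n + 1)) : LoopExpr n
  /-- `e` with its variable `i` replaced by the variable `ρ i` -/
  | rename {m n : ℕ} (ρ : Fin m → Fin n) (e : LoopExpr m) : LoopExpr n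
  /-- primitive recursion: start from `init` and apply `body` as often as `count` says, where
  variable `0` of `body` is the number of the pass, counted from `0`, variable `1` is the current
  value, and the others are shifted by two -/
  | fold {n : ℕ} (count init : LoopExpr n) (body : LoopExpr (n + 2)) : LoopExpr n

namespace LoopExpr

/-- The code of an expression when variable `i` is stored in the register `args i`, the first
instruction has number `o`, and the registers below `d` have to be preserved. The value is left in
the register `d`. A loop keeps its current value in `d`, the number of passes that are left in
`d + 1`, the number of the pass in `d + 2`, and the constants `1` and `0` in `d + 3` and
`d + 4`. -/
def compile : {n : ℕ} → LoopExpr n → (Fin n → ℕ) → ℕ → ℕ → Program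
  | _, const c, _, d, _ => [.const d c]
  | _, var i, args, d, _ => [.const d 0, .add d (args i) d]
  | _, add e f, args, d, o =>
    let P := e.compile args d o
    let Q := f.compile args (d + 1) (o + P.length)
    P ++ Q ++ [.add d d (d + 1)]
  | _, sub e f, args, d, o =>
    let P := e.compile args d o
    let Q := f.compile args (d + 1) (o + P.length)
    P ++ Q ++ [.sub d d (d + 1)]
  | _, read e, args, d, o => e.compile args d o ++ [.read d d]
  | _, bind e f, args, d, o =>
    let P := e.compile args d o
    let Q := f.compile (Matrix.vecCons d args) (d + 1) (o + P.length)
    P ++ Q ++ [.const d 0, .add d (d + 1) d]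
  | _, rename ρ e, args, d, o => e.compile (args ∘ ρ) d o
  | _, fold count init body, args, d, o =>
    let P := init.compile args d o
    let Q := count.compile args (d + 1) (o + P.length)
    let l := o + P.length + Q.length + 3
    let R := body.compile (Matrix.vecCons (d + 2) (Matrix.vecCons d args)) (d + 5) (l + 1)
    P ++ Q ++ [.const (d + 2) 0, .const (d + 3) 1, .const (d + 4) 0] ++
      [.jumpZero (d + 1) (l + R.length + 5)] ++ R ++
      [.add d (d + 5) (d + 4), .add (d + 2) (d + 2) (d + 3), .sub (d + 1) (d + 1) (d + 3),
        .jumpZero (d + 4) l]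

/-- A bound on the number of steps of the code of an expression, if none of its loops makes more
than `B` passes. -/
def bound : {n : ℕ} → LoopExpr n → ℕ → ℕ
  | _, const _, _ => 1
  | _, var _, _ => 2
  | _, add e f, B => e.bound B + f.bound B + 1
  | _, sub e f, B => e.bound B + f.bound B + 1
  | _, read e, B => e.bound B + 1
  | _, bind e f, B => e.bound B + f.bound B + 2
  | _, rename _ e, B => e.bound B
  | _, fold count init body, B => init.bound B + count.bound B + 4 + B * (body.bound B + 5)

/-- For a fixed expression, the number of steps is polynomial in the bound on its loops. -/
theorem bound_le {n : ℕ} (e : LoopExpr n) : ∃ C c : ℕ, ∀ B, e.bound B ≤ C * (B + 1) ^ c := by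
  -- All pieces are brought to the common form `C * (B + 1) ^ c`.
  have mono : ∀ {C c C' c' B : ℕ}, C ≤ C' → c ≤ c' → C * (B + 1) ^ c ≤ C' * (B + 1) ^ c' :=
    fun h h' => Nat.mul_le_mul h (Nat.pow_le_pow_right (Nat.succ_pos _) h')
  have add_le : ∀ {f g : ℕ → ℕ}, (∃ C c : ℕ, ∀ B, f B ≤ C * (B + 1) ^ c) →
      (∃ C c : ℕ, ∀ B, g B ≤ C * (B + 1) ^ c) → ∃ C c : ℕ, ∀ B, f B + g B ≤ C * (B + 1) ^ c := by
    rintro f g ⟨C, c, h⟩ ⟨C', c', h'⟩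
    refine ⟨C + C', max c c', fun B => ?_⟩
    rw [add_mul]
    exact add_le_add ((h B).trans (mono le_rfl (le_max_left _ _)))
      ((h' B).trans (mono le_rfl (le_max_right _ _)))
  have cst : ∀ a : ℕ, ∃ C c : ℕ, ∀ B : ℕ, a ≤ C * (B + 1) ^ c := fun a => ⟨a, 0, fun B => by simp⟩
  induction e with
  | const c => exact cst 1
  | var i => exact cst 2
  | add e f he hf => exact add_le (add_le he hf) (cst 1)
  | sub e f he hf => exact add_le (add_le he hf) (cst 1)
  | read e he => exact add_le he (cst 1)
  | bind e f he hf => exact add_le (add_le he hf) (cst 2)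
  | rename ρ e he => exact he
  | fold count init body hc hi hb =>
    refine add_le (add_le (add_le hi hc) (cst 4)) ?_
    obtain ⟨C, c, h⟩ := add_le hb (cst 5)
    refine ⟨C, c + 1, fun B => ?_⟩
    calc B * (body.bound B + 5) ≤ (B + 1) * (C * (B + 1) ^ c) := Nat.mul_le_mul (Nat.le_succ B) (h B)
      _ = C * (B + 1) ^ (c + 1) := by ring

end LoopExpr

theorem step_of_getElem? {P : Program} {input : List ℕ} {s : Config} {I : Instr}
    (h : P[s.pc]? = some I) : step P input s = I.exec input s := by
  simp [step, h]

/-- The instructions of the program `P` from number `o` on start with `Q`. -/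
def CodeAt (P : Program) (o : ℕ) (Q : Program) : Prop :=
  ∀ (i : ℕ) (h : i < Q.length), P[o + i]? = some Q[i]

theorem codeAt_append {P Q R : Program} {o : ℕ} :
    CodeAt P o (Q ++ R) ↔ CodeAt P o Q ∧ CodeAt P (o + Q.length) R := by
  constructor
  · refine fun h => ⟨fun i hi => ?_, fun i hi => ?_⟩
    · rw [h i (by simp; omega), List.getElem_append_left hi]
    · rw [add_assoc, h (Q.length + i) (by simp; omega), List.getElem_append_right (by omega)]
      simp
  · rintro ⟨hQ, hR⟩ i hi
    by_cases hi' : i < Q.length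
    · rw [List.getElem_append_left hi', hQ i hi']
    · rw [List.getElem_append_right (by omega), ← hR (i - Q.length) (by simp at hi; omega)]
      congr 1; omega

theorem codeAt_cons {P R : Program} {I : Instr} {o : ℕ} :
    CodeAt P o (I :: R) ↔ P[o]? = some I ∧ CodeAt P (o + 1) R := by
  rw [← List.singleton_append, codeAt_append]
  refine and_congr_left fun _ => ⟨fun h => h 0 (by simp), fun h i hi => ?_⟩
  obtain rfl : i = 0 := by simpa using hi
  exact h

/-- From `s`, the machine comes to `s'` within `T` steps. -/
def Reaches (P : Program) (input : List ℕ) (T : ℕ) (s s' : Config) : Prop :=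
  ∃ t ≤ T, (step P input)^[t] s = s'

theorem Reaches.refl {P : Program} {input : List ℕ} {s : Config} : Reaches P input 0 s s :=
  ⟨0, le_rfl, rfl⟩

theorem Reaches.trans {P : Program} {input : List ℕ} {T T' : ℕ} {s s' s'' : Config}
    (h : Reaches P input T s s') (h' : Reaches P input T' s' s'') :
    Reaches P input (T + T') s s'' := by
  obtain ⟨t, ht, rfl⟩ := h
  obtain ⟨t', ht', rfl⟩ := h'
  exact ⟨t' + t, by omega, Function.iterate_add_apply _ _ _ _⟩

theorem Reaches.mono {P : Program} {input : List ℕ} {T T' : ℕ} {s s' : Config}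
    (h : Reaches P input T s s') (hT : T ≤ T') : Reaches P input T' s s' :=
  let ⟨t, ht, e⟩ := h
  ⟨t, ht.trans hT, e⟩

theorem Reaches.of_eq {P : Program} {input : List ℕ} {T T' : ℕ} {s s' s'' : Config}
    (h : Reaches P input T s s') (hT : T ≤ T') (hs : s' = s'') : Reaches P input T' s s'' :=
  hs ▸ h.mono hT

theorem Reaches.head {P : Program} {input : List ℕ} {T o : ℕ} {σ : ℕ → ℕ} {s : Config} {I : Instr}
    (hI : P[o]? = some I) (h : Reaches P input T (I.exec input ⟨o, σ⟩) s) :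
    Reaches P input (T + 1) ⟨o, σ⟩ s := by
  obtain ⟨t, ht, e⟩ := h
  refine ⟨t + 1, by omega, ?_⟩
  rw [Function.iterate_succ_apply, step_of_getElem? (s := ⟨o, σ⟩) hI, e]

open LoopExpr (compile bound)

/-- At the values `v` of its variables, the expression `e` has the value `r`, and it is evaluated
within `bound e B` steps. This is expressed by what the compiled code does, in every program that
contains it and for every placement of the variables: it takes at most `bound e B` steps, leaves `r`
in the register `d`, and preserves the registers below `d`. -/
def Computes (input : List ℕ) (B : ℕ) {n : ℕ} (e : LoopExpr n) (v : Fin n → ℕ) (r : ℕ) : Prop :=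
  ∀ (P : Program) (args : Fin n → ℕ) (d o : ℕ) (σ : ℕ → ℕ), (∀ i, args i < d) →
    (∀ i, σ (args i) = v i) → CodeAt P o (e.compile args d o) →
    ∃ σ' : ℕ → ℕ, Reaches P input (e.bound B) ⟨o, σ⟩ ⟨o + (e.compile args d o).length, σ'⟩ ∧
      σ' d = r ∧ ∀ j < d, σ' j = σ j

namespace Computes

variable {input : List ℕ} {B n : ℕ} {v : Fin n → ℕ} {r : ℕ}

theorem const (c : ℕ) : Computes input B (.const c) v c := by
  intro P args d o σ _ _ hP
  simp only [compile, codeAt_cons] at hP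
  refine ⟨_, .head hP.1 .refl, ?_, ?_⟩
  · simp
  · intro j hj
    simp [hj.ne]

theorem var {i : Fin n} (h : v i = r) : Computes input B (.var i) v r := by
  intro P args d o σ ha hv hP
  simp only [compile, codeAt_cons] at hP
  refine ⟨_, .head hP.1 (.head hP.2.1 .refl), ?_, ?_⟩
  · simp [(ha i).ne, hv, h]
  · intro j hj
    simp [hj.ne]

theorem add {e f : LoopExpr n} {a b : ℕ} (he : Computes input B e v a)
    (hf : Computes input B f v b) : Computes input B (.add e f) v (a + b) := by
  intro P args d o σ ha hv hP
  simp only [compile, codeAt_append, codeAt_cons, List.length_append] at hP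
  obtain ⟨⟨hP₁, hP₂⟩, hP₃, -⟩ := hP
  obtain ⟨σ₁, h₁, r₁, s₁⟩ := he P args d o σ ha hv hP₁
  obtain ⟨σ₂, h₂, r₂, s₂⟩ := hf P args (d + 1) _ σ₁ (fun i => (ha i).trans (Nat.lt_succ_self d))
    (fun i => by rw [s₁ _ (ha i), hv]) hP₂
  refine ⟨Function.update σ₂ d (a + b), ?_, by simp, fun j hj => ?_⟩
  · refine (h₁.trans (h₂.trans (.head (by rw [← hP₃, ← add_assoc]) .refl))).of_eq
      (by simp only [bound]; omega) ?_
    simp [Instr.exec, Config.write, compile, r₂, s₂ d (by omega), r₁, add_assoc]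
  · simp [hj.ne, s₂ j (by omega), s₁ j hj]

theorem sub {e f : LoopExpr n} {a b : ℕ} (he : Computes input B e v a)
    (hf : Computes input B f v b) : Computes input B (.sub e f) v (a - b) := by
  intro P args d o σ ha hv hP
  simp only [compile, codeAt_append, codeAt_cons, List.length_append] at hP
  obtain ⟨⟨hP₁, hP₂⟩, hP₃, -⟩ := hP
  obtain ⟨σ₁, h₁, r₁, s₁⟩ := he P args d o σ ha hv hP₁
  obtain ⟨σ₂, h₂, r₂, s₂⟩ := hf P args (d + 1) _ σ₁ (fun i => (ha i).trans (Nat.lt_succ_self d))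
    (fun i => by rw [s₁ _ (ha i), hv]) hP₂
  refine ⟨Function.update σ₂ d (a - b), ?_, by simp, fun j hj => ?_⟩
  · refine (h₁.trans (h₂.trans (.head (by rw [← hP₃, ← add_assoc]) .refl))).of_eq
      (by simp only [bound]; omega) ?_
    simp [Instr.exec, Config.write, compile, r₂, s₂ d (by omega), r₁, add_assoc]
  · simp [hj.ne, s₂ j (by omega), s₁ j hj]

theorem read {e : LoopExpr n} {a : ℕ} (he : Computes input B e v a) :
    Computes input B (.read e) v (input.getD a 0) := by
  intro P args d o σ ha hv hP
  simp only [compile, codeAt_append, codeAt_cons] at hP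
  obtain ⟨hP₁, hP₂, -⟩ := hP
  obtain ⟨σ₁, h₁, r₁, s₁⟩ := he P args d o σ ha hv hP₁
  refine ⟨Function.update σ₁ d (input.getD a 0), ?_, by simp, fun j hj => ?_⟩
  · refine (h₁.trans (.head hP₂ .refl)).of_eq (by simp only [bound]; omega) ?_
    simp [Instr.exec, Config.write, compile, r₁, add_assoc]
  · simp [hj.ne, s₁ j hj]

theorem bind {e : LoopExpr n} {f : LoopExpr (n + 1)} {a : ℕ} (he : Computes input B e v a)
    (hf : Computes input B f (Matrix.vecCons a v) r) : Computes input B (.bind e f) v r := by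
  intro P args d o σ ha hv hP
  simp only [compile, codeAt_append, codeAt_cons, List.length_append] at hP
  obtain ⟨⟨hP₁, hP₂⟩, hP₃, hP₄, -⟩ := hP
  obtain ⟨σ₁, h₁, r₁, s₁⟩ := he P args d o σ ha hv hP₁
  obtain ⟨σ₂, h₂, r₂, s₂⟩ := hf P (Matrix.vecCons d args) (d + 1) _ σ₁
    (Fin.cases (by simp) fun i => by simpa using (ha i).trans (Nat.lt_succ_self d))
    (Fin.cases (by simpa using r₁) fun i => by simp [s₁ _ (ha i), hv]) hP₂
  rw [← add_assoc] at hP₃ hP₄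
  refine ⟨Function.update σ₂ d r, ?_, by simp, fun j hj => ?_⟩
  · refine (h₁.trans (h₂.trans (.head hP₃ (.head hP₄ .refl)))).of_eq
      (by simp only [bound]; omega) ?_
    simp [Instr.exec, Config.write, compile, r₂, add_assoc]
  · simp [hj.ne, s₂ j (by omega), s₁ j hj]

theorem rename {m : ℕ} {ρ : Fin m → Fin n} {e : LoopExpr m} {w : Fin m → ℕ} (hw : v ∘ ρ = w)
    (he : Computes input B e w r) : Computes input B (.rename ρ e) v r := by
  subst hw
  exact fun P args d o σ ha hv hP => he P (args ∘ ρ) d o σ (fun i => ha _) (fun i => hv _) hP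

/-- The rule for loops: `a i` is the value after `i` passes. -/
theorem fold {count init : LoopExpr n} {body : LoopExpr (n + 2)} {c : ℕ} (a : ℕ → ℕ)
    (hcount : Computes input B count v c) (hc : c ≤ B) (hinit : Computes input B init v (a 0))
    (hbody : ∀ i < c,
      Computes input B body (Matrix.vecCons i (Matrix.vecCons (a i) v)) (a (i + 1))) :
    Computes input B (.fold count init body) v (a c) := by
  intro P args d o σ ha hv hP
  simp only [compile, codeAt_append, codeAt_cons, List.length_append, List.length_cons,
    List.length_nil] at hP
  obtain ⟨⟨⟨⟨⟨hP₁, hP₂⟩, hP₃, hP₄, hP₅, -⟩, hP₆, -⟩, hP₇⟩, hP₈, hP₉, hP₁₀, hP₁₁, -⟩ := hP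
  obtain ⟨σ₁, h₁, r₁, s₁⟩ := hinit P args d o σ ha hv hP₁
  obtain ⟨σ₂, h₂, r₂, s₂⟩ := hcount P args (d + 1) _ σ₁
    (fun i => (ha i).trans (Nat.lt_succ_self d)) (fun i => by rw [s₁ _ (ha i), hv]) hP₂
  set p := (init.compile args d o).length with hp
  set q := (count.compile args (d + 1) (o + p)).length with hq
  set l := o + p + q + 3 with hl
  set R := body.compile (Matrix.vecCons (d + 2) (Matrix.vecCons d args)) (d + 5) (l + 1) with hR
  replace hP₄ : P[o + p + q + 1]? = some (.const (d + 3) 1) := by rw [← hP₄]; congr 1; omega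
  replace hP₅ : P[o + p + q + 1 + 1]? = some (.const (d + 4) 0) := by rw [← hP₅]; congr 1; omega
  replace hP₃ : P[o + p + q]? = some (.const (d + 2) 0) := by rw [← hP₃]; congr 1; omega
  replace hP₆ : P[l]? = some (.jumpZero (d + 1) (l + R.length + 5)) := by
    rw [← hP₆]; congr 1; omega
  replace hP₇ : CodeAt P (l + 1) R := by convert hP₇ using 1; omega
  replace hP₈ : P[l + 1 + R.length]? = some (.add d (d + 5) (d + 4)) := by
    rw [← hP₈]; congr 1; omega
  replace hP₉ : P[l + 1 + R.length + 1]? = some (.add (d + 2) (d + 2) (d + 3)) := by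
    rw [← hP₉]; congr 1; omega
  replace hP₁₀ : P[l + 1 + R.length + 1 + 1]? = some (.sub (d + 1) (d + 1) (d + 3)) := by
    rw [← hP₁₀]; congr 1; omega
  replace hP₁₁ : P[l + 1 + R.length + 1 + 1 + 1]? = some (.jumpZero (d + 4) l) := by
    rw [← hP₁₁]; congr 1; omega
  -- `k` passes are left; the registers are as described at `compile`.
  have loop : ∀ (k i : ℕ) (τ : ℕ → ℕ), i + k = c → τ d = a i → τ (d + 1) = k → τ (d + 2) = i →
      τ (d + 3) = 1 → τ (d + 4) = 0 → (∀ j < d, τ j = σ j) →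
      ∃ σ' : ℕ → ℕ, Reaches P input (1 + k * (body.bound B + 5)) ⟨l, τ⟩
        ⟨l + R.length + 5, σ'⟩ ∧ σ' d = a c ∧ ∀ j < d, σ' j = σ j := by
    intro k
    induction k with
    | zero =>
      intro i τ hi t₀ t₁ t₂ t₃ t₄ ht
      refine ⟨τ, ?_, by rw [t₀, ← hi, add_zero], ht⟩
      refine (Reaches.head hP₆ .refl).of_eq (by omega) ?_
      simp [Instr.exec, t₁]
    | succ k ih =>
      intro i τ hi t₀ t₁ t₂ t₃ t₄ ht
      obtain ⟨τ₁, g₁, w₁, z₁⟩ := hbody i (by omega) P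
        (Matrix.vecCons (d + 2) (Matrix.vecCons d args)) (d + 5) (l + 1) τ
        (Fin.cases (by simp) (Fin.cases (by simp) fun j => by simpa using (ha j).trans (by omega)))
        (Fin.cases (by simpa using t₂) (Fin.cases (by simpa using t₀)
          fun j => by simp [ht _ (ha j), hv]))
        hP₇
      rw [← hR] at g₁
      obtain ⟨σ', g₂, w₂, z₂⟩ := ih (i + 1) (Function.update (Function.update (Function.update τ₁
          d (a (i + 1))) (d + 2) (i + 1)) (d + 1) k) (by omega) (by simp) (by simp) (by simp)
        (by simp [z₁, t₃]) (by simp [z₁, t₄])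
        (fun j hj => by simp [hj.ne, (show j ≠ d + 1 by omega), (show j ≠ d + 2 by omega),
          z₁ j (by omega), ht j hj])
      refine ⟨σ', ?_, w₂, z₂⟩
      refine Reaches.of_eq (Reaches.head (T := body.bound B + (4 + (1 + k * (body.bound B + 5))))
        hP₆ ?_) (by ring_nf; omega) rfl
      have e₁ : Instr.exec input ⟨l, τ⟩ (.jumpZero (d + 1) (l + R.length + 5)) = ⟨l + 1, τ⟩ := by
        simp [Instr.exec, t₁]
      rw [e₁]
      refine g₁.trans ((Reaches.head hP₈ (.head hP₉ (.head hP₁₀ (.head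
        (T := 1 + k * (body.bound B + 5)) hP₁₁ ?_)))).mono (by omega))
      convert g₂ using 1
      simp [Instr.exec, z₁, w₁, t₁, t₂, t₃, t₄]
  obtain ⟨σ', h₃, r₃, s₃⟩ := loop c 0 (Function.update (Function.update (Function.update σ₂
      (d + 2) 0) (d + 3) 1) (d + 4) 0) (by omega) (by simp [s₂, r₁]) (by simp [r₂]) (by simp)
    (by simp) (by simp) (fun j hj => by
      simp [(show j ≠ d + 2 by omega), (show j ≠ d + 3 by omega), (show j ≠ d + 4 by omega),
        s₂ j (by omega), s₁ j hj])
  refine ⟨σ', ?_, r₃, s₃⟩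
  refine (h₁.trans (h₂.trans (.head hP₃ (.head hP₄ (.head hP₅ h₃))))).of_eq ?_ ?_
  · have := Nat.mul_le_mul_right (body.bound B + 5) hc
    simp only [bound]
    omega
  · simp [compile, ← hp, ← hq, ← hl, ← hR]
    omega

end Computes

theorem haltsWithin_of_computes {input : List ℕ} {B r : ℕ} {e : LoopExpr 0}
    (h : Computes input B e ![] r) : HaltsWithin (e.compile ![] 0 0) input (e.bound B) r := by
  obtain ⟨σ', ⟨t, ht, e⟩, hr, -⟩ := h (e.compile ![] 0 0) ![] 0 0 (fun _ => 0) (fun i => i.elim0)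
    (fun i => i.elim0) (fun i hi => by simp [hi])
  exact ⟨t, ht, by simp [initial, e], by simp [initial, e, hr]⟩

/-- The number `1` if `p` holds, and `0` otherwise: how a truth value is stored in a register. -/
noncomputable def ind (p : Prop) : ℕ := open Classical in if p then 1 else 0

end RAM

/-- A problem is fixed-parameter tractable if an expression decides it whose loops make no more
passes than the size plus a computable function of the parameter. -/
theorem fixedParameterTractable_of_computes {α : Type} {encode : α → List ℕ} {size param : α → ℕ}
    {yes : α → Prop} (e : RAM.LoopExpr 0) (g : ℕ → ℕ) (hg : Computable g)
    (he : ∀ x, RAM.Computes (encode x) (size x + g (param x)) e ![] (RAM.ind (yes x))) :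
    FixedParameterTractable encode size param yes := by
  obtain ⟨C, c, h⟩ := e.bound_le
  have hpow : Computable₂ fun a b : ℕ => a ^ b :=
    (Primrec₂.unpaired'.1 Nat.Primrec.pow).to_comp
  refine ⟨e.compile ![] 0 0, fun k => C * (g k + 1) ^ c, c, ?_, fun x => ?_⟩
  · exact Primrec.nat_mul.to_comp.comp (.const C)
      (hpow.comp (Primrec.succ.to_comp.comp hg) (.const c))
  · have hB : e.bound (size x + g (param x)) ≤ C * (g (param x) + 1) ^ c * (size x + 1) ^ c := by
      refine (h _).trans ?_
      rw [mul_assoc, ← mul_pow]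
      exact Nat.mul_le_mul_left _ (Nat.pow_le_pow_left (by nlinarith) _)
    obtain ⟨t, ht, h'⟩ := RAM.haltsWithin_of_computes (he x)
    constructor <;> intro hx <;> refine ⟨t, ht.trans hB, ?_⟩ <;> simpa [RAM.ind, hx] using h'

/-! ### Solutions as maps -/

namespace Delegation

section Choice

variable {V : Type} [Fintype V] {G : Digraph V} {g : V → V}

/-- The map `g` fixes the sinks, and sends every other vertex to one of its out-neighbours. -/
structure IsChoice (G : Digraph V) (g : V → V) : Prop where
  sink : ∀ v, IsSink G v → g v = v
  adj : ∀ v, ¬ IsSink G v → G.Adj v (g v)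

/-- The graph with the edges `u ⟶ g u` for the non-sinks `u` of `G`. -/
def choiceGraph (G : Digraph V) (g : V → V) : Digraph V where
  Adj u v := ¬ IsSink G u ∧ g u = v

theorem exists_iterate_eq_iterate (g : V → V) (v : V) :
    ∃ i j, i < j ∧ j ≤ Fintype.card V ∧ g^[i] v = g^[j] v := by
  obtain ⟨i, hi, j, hj, hij, h⟩ := Finset.exists_ne_map_eq_of_card_lt_of_maps_to
    (s := Finset.range (Fintype.card V + 1)) (t := Finset.univ) (by simp)
    (f := fun i => g^[i] v) (fun _ _ => Finset.mem_coe.2 (Finset.mem_univ _))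
  simp only [Finset.mem_range] at hi hj
  rcases lt_or_gt_of_ne hij with hlt | hlt
  · exact ⟨i, j, hlt, by omega, h⟩
  · exact ⟨j, i, hlt, by omega, h.symm⟩

/-- A fixed point that is reached from `v` at all is reached within `card V` steps. -/
theorem iterate_card_eq {t v : V} (ht : g t = t) {j : ℕ} (h : g^[j] v = t) :
    g^[Fintype.card V] v = t := by
  obtain ⟨i, i', hi, hi', e⟩ := exists_iterate_eq_iterate g v
  induction j using Nat.strong_induction_on with
  | _ j ih =>
    by_cases hj : j ≤ Fintype.card V
    · obtain ⟨d, hd⟩ := Nat.exists_eq_add_of_le hj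
      rw [hd, add_comm, Function.iterate_add_apply, h, Function.iterate_fixed ht]
    · refine ih (j - i' + i) (by omega) ?_
      rw [Function.iterate_add_apply, e, ← Function.iterate_add_apply]
      rwa [Nat.sub_add_cancel (by omega)]

theorem reflTransGen_choiceGraph_iff (hg : IsChoice G g) {t : V} (ht : IsSink G t) (v : V) :
    Relation.ReflTransGen (choiceGraph G g).Adj v t ↔ g^[Fintype.card V] v = t := by
  constructor
  · intro h
    obtain ⟨j, hj⟩ : ∃ j, g^[j] v = t := by
      induction h using Relation.ReflTransGen.head_induction_on with
      | refl => exact ⟨0, rfl⟩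
      | head h _ ih =>
        obtain ⟨j, hj⟩ := ih
        exact ⟨j + 1, by rw [Function.iterate_succ_apply, h.2, hj]⟩
    exact iterate_card_eq (hg.sink t ht) hj
  · generalize Fintype.card V = N
    intro h
    induction N generalizing v with
    | zero => exact h ▸ .refl
    | succ N ih =>
      rw [Function.iterate_succ_apply] at h
      by_cases hv : IsSink G v
      · rw [hg.sink v hv] at h
        exact ih v h
      · exact .head ⟨hv, rfl⟩ (ih _ h)

theorem weight_choiceGraph (hg : IsChoice G g) {t : V} (ht : IsSink G t) :
    weight (choiceGraph G g) t = {v | g^[Fintype.card V] v = t}.ncard := by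
  simp [weight, reflTransGen_choiceGraph_iff hg ht]

theorem acyclic_choiceGraph_iff (hg : IsChoice G g) :
    Acyclic (choiceGraph G g) ↔ ∀ v, IsSink G (g^[Fintype.card V] v) := by
  constructor
  · intro h v
    by_contra hv
    -- The first `card V` iterates are non-sinks and two of them agree, which closes a cycle.
    have hns : ∀ j ≤ Fintype.card V, ¬ IsSink G (g^[j] v) := fun j hj hs => by
      obtain ⟨d, hd⟩ := Nat.exists_eq_add_of_le hj
      rw [hd, add_comm, Function.iterate_add_apply, Function.iterate_fixed (hg.sink _ hs)] at hv
      exact hv hs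
    obtain ⟨i, j, hij, hj, e⟩ := exists_iterate_eq_iterate g v
    have key : ∀ d, i + d < j →
        Relation.TransGen (choiceGraph G g).Adj (g^[i] v) (g^[i + d + 1] v) := by
      intro d hd
      have hstep : (choiceGraph G g).Adj (g^[i + d] v) (g^[i + d + 1] v) :=
        ⟨hns _ (by omega), (Function.iterate_succ_apply' _ _ _).symm⟩
      induction d with
      | zero => exact .single hstep
      | succ d ih =>
        exact .tail (ih (by omega)
          ⟨hns _ (by omega), (Function.iterate_succ_apply' _ _ _).symm⟩) hstep
    have := key (j - i - 1) (by omega)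
    rw [show i + (j - i - 1) + 1 = j by omega, ← e] at this
    exact h _ this
  · intro h v hv
    -- Conversely, all iterates of a vertex on a cycle lie on a cycle.
    have key : ∀ N, Relation.TransGen (choiceGraph G g).Adj (g^[N] v) (g^[N] v) := by
      intro N
      induction N with
      | zero => exact hv
      | succ N ih =>
        rw [Function.iterate_succ_apply']
        obtain ⟨w, hw, hw'⟩ := Relation.TransGen.head'_iff.1 ih
        obtain rfl : g (g^[N] v) = w := hw.2
        exact Relation.TransGen.tail' hw' hw
    obtain ⟨w, hw, -⟩ := Relation.TransGen.head'_iff.1 (key (Fintype.card V))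
    exact hw.1 (h v)

/-- The map `g` describes a solution in which every sink has weight at most `b` and which is
acyclic if `acyclic` holds. -/
structure IsGoodChoice (acyclic : Prop) (G : Digraph V) (b : ℕ) (g : V → V) : Prop
    extends IsChoice G g where
  ncard_le : ∀ t, IsSink G t → {v | g^[Fintype.card V] v = t}.ncard ≤ b
  isSink_iterate : acyclic → ∀ v, IsSink G (g^[Fintype.card V] v)

theorem exists_isSolution_iff (acyclic : Prop) (G : Digraph V) (lam : ℤ) :
    (∃ H, IsSolution G lam H ∧ (acyclic → Acyclic H)) ↔
      ∃ g, IsGoodChoice acyclic G lam.toNat g := by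
  -- A sink is counted in its own weight, so a bound `lam ≤ 0` excludes sinks, as does `lam.toNat`.
  have hpos : ∀ (g : V → V), IsChoice G g → ∀ t, IsSink G t →
      0 < {v | g^[Fintype.card V] v = t}.ncard := fun g hg t ht =>
    (Set.ncard_pos (Set.toFinite _)).2 ⟨t, Function.iterate_fixed (hg.sink t ht) _⟩
  constructor
  · rintro ⟨H, hH, hac⟩
    classical
    choose! s hs hs' using hH.outdegree
    have hg : IsChoice G fun v => if IsSink G v then v else s v :=
      ⟨fun v hv => by simp [hv], fun v hv => by simpa [hv] using hH.subgraph (hs v hv)⟩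
    have e : choiceGraph G (fun v => if IsSink G v then v else s v) = H := by
      ext u v
      by_cases hu : IsSink G u
      · simpa [choiceGraph, hu] using fun h => hu v (hH.subgraph h)
      · simp only [choiceGraph, hu, not_false_eq_true, if_false, true_and]
        exact ⟨fun h => h ▸ hs u hu, fun h => (hs' u hu v h).symm⟩
    refine ⟨_, hg, fun t ht => ?_, fun h => ?_⟩
    · have h₁ := hH.weight_le t ht
      rw [← e, weight_choiceGraph hg ht] at h₁
      omega
    · rw [← acyclic_choiceGraph_iff hg, e]
      exact hac h
  · rintro ⟨g, hg⟩
    refine ⟨choiceGraph G g, ⟨?_, fun v hv => ⟨g v, ⟨hv, rfl⟩, fun w hw => hw.2.symm⟩,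
      fun t ht => ?_⟩, fun h => (acyclic_choiceGraph_iff hg.toIsChoice).2 (hg.isSink_iterate h)⟩
    · rintro u v ⟨hu, rfl⟩
      exact hg.adj u hu
    · have h₁ := hg.ncard_le t ht
      have h₂ := hpos g hg.toIsChoice t ht
      rw [weight_choiceGraph hg.toIsChoice ht]
      omega

/-- Automorphisms of the graph act on the solutions. -/
theorem IsGoodChoice.conj {acyclic : Prop} {b : ℕ} (hg : IsGoodChoice acyclic G b g)
    (σ : Equiv.Perm V) (hσ : ∀ u v, G.Adj (σ u) (σ v) ↔ G.Adj u v) :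
    IsGoodChoice acyclic G b (σ ∘ g ∘ σ.symm) := by
  have hs : ∀ v, IsSink G (σ v) ↔ IsSink G v := fun v =>
    σ.surjective.forall.trans (forall_congr' fun w => not_congr (hσ v w))
  have hit : ∀ N v, (σ ∘ g ∘ σ.symm)^[N] v = σ (g^[N] (σ.symm v)) := by
    intro N
    induction N with
    | zero => simp
    | succ N ih => intro v; rw [Function.iterate_succ_apply', ih, Function.iterate_succ_apply']; simp
  refine ⟨⟨fun v hv => ?_, fun v hv => ?_⟩, fun t ht => ?_, fun h v => ?_⟩
  · rw [← σ.apply_symm_apply v, hs] at hv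
    simp [hg.sink _ hv]
  · rw [← σ.apply_symm_apply v, hs] at hv
    simpa using (hσ _ _).2 (hg.adj _ hv)
  · rw [← σ.apply_symm_apply t, hs] at ht
    refine le_trans (le_of_eq ?_) (hg.ncard_le _ ht)
    simp only [hit]
    rw [← Set.ncard_image_of_injective _ σ.symm.injective]
    congr 1
    ext v
    simp [Equiv.eq_symm_apply, Equiv.image_eq_preimage_symm]
  · rw [hit, hs]
    exact hg.isSink_iterate h _

end Choice

/-! ### Restriction to few sinks -/

section Kept

variable {n : ℕ} {G : Digraph (Fin n)}

/-- The sinks with a smaller number and the same in-neighbours as `t`. -/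
def smallerTwins (G : Digraph (Fin n)) (t : Fin n) : Set (Fin n) :=
  {s | s < t ∧ IsSink G s ∧ ∀ u, G.Adj u s ↔ G.Adj u t}

/-- Non-sinks are kept, and a sink is kept if it has fewer smaller twins than there are
non-sinks. -/
def Kept (G : Digraph (Fin n)) (t : Fin n) : Prop :=
  IsSink G t → (smallerTwins G t).ncard < {v | ¬ IsSink G v}.ncard

/-- If there is a solution, then there is one that uses kept vertices only: replacing a sink which
is not kept by an unused smaller twin decreases `∑ v, g v`. -/
theorem IsGoodChoice.exists_kept {acyclic : Prop} {b : ℕ} {g : Fin n → Fin n}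
    (hg : IsGoodChoice acyclic G b g) :
    ∃ g', IsGoodChoice acyclic G b g' ∧ ∀ v, ¬ IsSink G v → Kept G (g' v) := by
  classical
  induction hN : ∑ v, (g v : ℕ) using Nat.strong_induction_on generalizing g with
  | _ N ih =>
    subst hN
    by_contra! hcon
    obtain ⟨v, hv, hk⟩ := hcon g hg
    simp only [Kept, Classical.not_imp, not_lt] at hk
    obtain ⟨hw, hk⟩ := hk
    set w := g v
    -- At most `k - 1` vertices other than `w` are values of `g` on the `k` non-sinks, so that one
    -- of the at least `k` smaller twins of `w` is not.
    obtain ⟨t, ht, htg⟩ : ∃ t ∈ smallerTwins G w, t ∉ (g '' {v | ¬ IsSink G v}) \ {w} := by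
      by_contra! hsub
      have h₁ := Set.ncard_le_ncard (show smallerTwins G w ⊆ _ from hsub) (Set.toFinite _)
      have h₂ := Set.ncard_sdiff_singleton_lt_of_mem (show w ∈ g '' {v | ¬ IsSink G v} from
        ⟨v, hv, rfl⟩) (Set.toFinite _)
      have h₃ := Set.ncard_image_le (f := g) (Set.toFinite {v | ¬ IsSink G v})
      omega
    obtain ⟨htw, hts, htwin⟩ := ht
    have htg' : ∀ u, ¬ IsSink G u → g u ≠ t := fun u hu e => htg ⟨⟨u, hu, e⟩, htw.ne⟩
    have hfix : ∀ u, ¬ IsSink G u → Equiv.swap t w u = u := fun u hu =>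
      Equiv.swap_apply_of_ne_of_ne (fun e => hu (e ▸ hts)) (fun e => hu (e ▸ hw))
    have hsink : ∀ u, IsSink G u → IsSink G (Equiv.swap t w u) := fun u hu => by
      rw [Equiv.swap_apply_def]; split_ifs <;> assumption
    have hσ : ∀ u u', G.Adj (Equiv.swap t w u) (Equiv.swap t w u') ↔ G.Adj u u' := by
      intro u u'
      by_cases hu : IsSink G u
      · exact iff_of_false (hsink u hu _) (hu _)
      · rw [hfix u hu, Equiv.swap_apply_def]
        split_ifs with h₁ h₂
        · rw [h₁, htwin]
        · rw [h₂, htwin]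
        · rfl
    have hg' := hg.conj _ hσ
    have hlt : ∑ u, ((Equiv.swap t w ∘ g ∘ (Equiv.swap t w).symm) u : ℕ) < ∑ u, (g u : ℕ) := by
      refine Finset.sum_lt_sum (fun u _ => ?_) ⟨v, Finset.mem_univ _, ?_⟩
      · by_cases hu : IsSink G u
        · rw [hg'.sink u hu, hg.sink u hu]
        · have : (Equiv.swap t w).symm u = u := by simpa using hfix u hu
          simp only [Function.comp_apply, this]
          rw [Equiv.swap_apply_def, if_neg (htg' u hu)]
          split_ifs with h
          · rw [h]; exact Fin.val_le_of_le htw.le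
          · rfl
      · have : (Equiv.swap t w).symm v = v := by simpa using hfix v hv
        simp only [Function.comp_apply, this]
        rw [show g v = w from rfl, Equiv.swap_apply_right]
        exact htw
    obtain ⟨g'', h₁, h₂⟩ := ih _ hlt hg' rfl
    obtain ⟨v', hv', hv''⟩ := hcon g'' h₁
    exact hv'' (h₂ v' hv')

theorem ncard_kept_le (G : Digraph (Fin n)) :
    {t | Kept G t}.ncard ≤
      {v | ¬ IsSink G v}.ncard + {v | ¬ IsSink G v}.ncard * 2 ^ {v | ¬ IsSink G v}.ncard := by
  set N : Set (Fin n) := {v | ¬ IsSink G v}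
  have hsub : {t | Kept G t} ⊆ N ∪ {t | IsSink G t ∧ Kept G t} := fun t ht => by
    by_cases h : IsSink G t
    · exact .inr ⟨h, ht⟩
    · exact .inl h
  refine (Set.ncard_le_ncard hsub (Set.toFinite _)).trans
    ((Set.ncard_union_le _ _).trans (Nat.add_le_add_left ?_ _))
  -- A kept sink is determined by its rank among its twins and its set of in-neighbours.
  have hinj : Set.InjOn (fun t => ((smallerTwins G t).ncard, {u | G.Adj u t}))
      {t | IsSink G t ∧ Kept G t} := by
    have key : ∀ s t, IsSink G s → (∀ u, G.Adj u s ↔ G.Adj u t) → s < t →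
        (smallerTwins G s).ncard < (smallerTwins G t).ncard := fun s t hs h hst =>
      Set.ncard_lt_ncard ⟨fun r hr => ⟨hr.1.trans hst, hr.2.1, fun u => (hr.2.2 u).trans (h u)⟩,
        fun h' => (h' (show s ∈ smallerTwins G t from ⟨hst, hs, h⟩)).1.false⟩ (Set.toFinite _)
    rintro s ⟨hs, -⟩ t ⟨ht, -⟩ e
    simp only [Prod.mk.injEq, Set.ext_iff, Set.mem_ofPred_eq] at e
    rcases lt_trichotomy s t with h | h | h
    · have := key s t hs e.2 h; omega
    · exact h
    · have := key t s ht (fun u => (e.2 u).symm) h; omega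
  rw [← hinj.ncard_image]
  have hsub' : (fun t => ((smallerTwins G t).ncard, {u | G.Adj u t})) ''
      {t | IsSink G t ∧ Kept G t} ⊆ Set.Iio N.ncard ×ˢ (𝒫 N) := by
    rintro _ ⟨t, ⟨ht, hk⟩, rfl⟩
    exact ⟨hk ht, fun u hu hs => hs t hu⟩
  refine (Set.ncard_le_ncard hsub' (Set.toFinite _)).trans ?_
  rw [Set.ncard_prod, Set.ncard_powerset _ (Set.toFinite _)]
  simp [Set.ncard_eq_toFinset_card']

end Kept

end Delegation

/-! ### Logic and arithmetic in the expression language -/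

namespace RAM

theorem ind_eq_one {p : Prop} (h : p) : ind p = 1 := if_pos h

theorem ind_eq_zero {p : Prop} (h : ¬ p) : ind p = 0 := if_neg h

namespace LoopExpr

variable {n : ℕ}

/-- The value of `f` at `e`. -/
def comp₁ (f : LoopExpr 1) (e : LoopExpr n) : LoopExpr n := bind e (rename ![0] f)

/-- The value of `f` at `e` and `e'`. -/
def comp₂ (f : LoopExpr 2) (e e' : LoopExpr n) : LoopExpr n :=
  bind e (bind (rename Fin.succ e') (rename ![1, 0] f))

def mul : LoopExpr 2 := fold (var 1) (const 0) (add (var 1) (var 2))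

def not (e : LoopExpr n) : LoopExpr n := sub (const 1) e

def and (e f : LoopExpr n) : LoopExpr n := sub e (not f)

def or (e f : LoopExpr n) : LoopExpr n := not (and (not e) (not f))

def le (e f : LoopExpr n) : LoopExpr n := sub (const 1) (sub e f)

def lt (e f : LoopExpr n) : LoopExpr n := le (add e (const 1)) f

def eq (e f : LoopExpr n) : LoopExpr n := and (le e f) (le f e)

/-- `e` if `p` is `1`, and `f` if `p` is `0`: a loop with `p` passes that starts from `f`. Thus `e` is
evaluated only if `p` is `1`, whereas `f` is always evaluated. -/
def ite (p e f : LoopExpr n) : LoopExpr n := fold p f (rename (fun i => i.succ.succ) e)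

/-- The number of `i < N` with `p i = 1`. Variable `0` of `p` is `i`. -/
def count (N : LoopExpr n) (p : LoopExpr (n + 1)) : LoopExpr n :=
  fold N (const 0) (add (var 1) (rename (Matrix.vecCons 0 fun i => i.succ.succ) p))

/-- The truth value of `∀ i < N, p i`. -/
def all (N : LoopExpr n) (p : LoopExpr (n + 1)) : LoopExpr n := not (count N (not p))

/-- The truth value of `∃ i < N, p i`. -/
def ex (N : LoopExpr n) (p : LoopExpr (n + 1)) : LoopExpr n := not (all N (not p))

/-- The quotient of variable `0` by variable `1`, as the number of `q < a` with
`(q + 1) * b ≤ a`. -/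
def div : LoopExpr 2 :=
  count (var 0) (le (comp₂ mul (add (var 0) (const 1)) (var 2)) (var 1))

def mod : LoopExpr 2 := sub (var 0) (comp₂ mul div (var 1))

end LoopExpr

namespace Computes

variable {input : List ℕ} {B n : ℕ} {v : Fin n → ℕ}

theorem comp₁ {f : LoopExpr 1} {e : LoopExpr n} {a r : ℕ} (hf : Computes input B f ![a] r)
    (he : Computes input B e v a) : Computes input B (f.comp₁ e) v r :=
  he.bind (.rename (by ext i; fin_cases i; rfl) hf)

theorem comp₂ {f : LoopExpr 2} {e e' : LoopExpr n} {a a' r : ℕ}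
    (hf : Computes input B f ![a, a'] r) (he : Computes input B e v a)
    (he' : Computes input B e' v a') :
    Computes input B (f.comp₂ e e') v r :=
  he.bind (.bind (.rename rfl he') (.rename (by ext i; fin_cases i <;> rfl) hf))

theorem mul {a b : ℕ} (hb : b ≤ B) : Computes input B .mul ![a, b] (a * b) := by
  rw [mul_comm]
  refine .fold (fun i => i * a) (.var rfl) hb (by simpa using .const 0) fun i _ => ?_
  rw [Nat.succ_mul]
  exact .add (.var rfl) (.var rfl)

theorem of_eq {e : LoopExpr n} {a b : ℕ} (h : Computes input B e v a) (hab : a = b) :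
    Computes input B e v b := hab ▸ h

variable {p q : Prop} {e f : LoopExpr n}

theorem not (he : Computes input B e v (ind p)) : Computes input B e.not v (ind (¬ p)) :=
  ((const 1).sub he).of_eq (by by_cases hp : p <;> simp [ind, hp])

theorem and (he : Computes input B e v (ind p)) (hf : Computes input B f v (ind q)) :
    Computes input B (e.and f) v (ind (p ∧ q)) :=
  (he.sub hf.not).of_eq (by by_cases hp : p <;> by_cases hq : q <;> simp [ind, hp, hq])

theorem or (he : Computes input B e v (ind p)) (hf : Computes input B f v (ind q)) :
    Computes input B (e.or f) v (ind (p ∨ q)) :=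
  (he.not.and hf.not).not.of_eq (by rw [not_and_or, not_not, not_not])

theorem le {a b : ℕ} (he : Computes input B e v a) (hf : Computes input B f v b) :
    Computes input B (e.le f) v (ind (a ≤ b)) :=
  ((const 1).sub (he.sub hf)).of_eq (by unfold ind; split_ifs <;> omega)

theorem lt {a b : ℕ} (he : Computes input B e v a) (hf : Computes input B f v b) :
    Computes input B (e.lt f) v (ind (a < b)) :=
  (he.add (const 1)).le hf

theorem eq {a b : ℕ} (he : Computes input B e v a) (hf : Computes input B f v b) :
    Computes input B (e.eq f) v (ind (a = b)) :=
  ((he.le hf).and (hf.le he)).of_eq (congrArg ind (propext le_antisymm_iff.symm))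

theorem ite_of_pos {p : LoopExpr n} {q : Prop} {a r : ℕ} (hB : 1 ≤ B)
    (hp : Computes input B p v (ind q)) (h : q) (he : Computes input B e v r)
    (hf : Computes input B f v a) : Computes input B (p.ite e f) v r := by
  rw [ind_eq_one h] at hp
  refine .fold (fun i => if i = 0 then a else r) hp hB hf fun i _ => .rename rfl ?_
  exact he

theorem ite_of_neg {p : LoopExpr n} {q : Prop} {r : ℕ}
    (hp : Computes input B p v (ind q)) (h : ¬ q) (hf : Computes input B f v r) :
    Computes input B (p.ite e f) v r := by
  rw [ind_eq_zero h] at hp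
  exact .fold (fun _ => r) hp (Nat.zero_le _) hf fun i hi => absurd hi (Nat.not_lt_zero i)

theorem count {N : LoopExpr n} {e : LoopExpr (n + 1)} {c : ℕ} {p : ℕ → Prop} [DecidablePred p]
    (hN : Computes input B N v c) (hc : c ≤ B)
    (he : ∀ i < c, Computes input B e (Matrix.vecCons i v) (ind (p i))) :
    Computes input B (N.count e) v (Nat.count p c) := by
  refine .fold (fun i => Nat.count p i) hN hc (by simpa using .const 0) fun i hi => ?_
  rw [Nat.count_succ, show (if p i then 1 else 0) = ind (p i) by unfold ind; congr]
  exact .add (.var rfl) (.rename (by ext j; refine Fin.cases rfl (fun j => rfl) j) (he i hi))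

theorem all {N : LoopExpr n} {e : LoopExpr (n + 1)} {c : ℕ} {p : ℕ → Prop}
    (hN : Computes input B N v c) (hc : c ≤ B)
    (he : ∀ i < c, Computes input B e (Matrix.vecCons i v) (ind (p i))) :
    Computes input B (N.all e) v (ind (∀ i < c, p i)) := by
  classical
  refine ((const 1).sub (count hN hc fun i hi => (he i hi).not)).of_eq ?_
  by_cases h : ∀ i < c, p i
  · rw [ind_eq_one h, Nat.count_iff_forall_not.2 fun i hi => not_not.2 (h i hi)]
  · rw [ind_eq_zero h, Nat.sub_eq_zero_iff_le, Nat.one_le_iff_ne_zero, Nat.count_ne_iff_exists]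
    push Not at h
    exact h

theorem ex {N : LoopExpr n} {e : LoopExpr (n + 1)} {c : ℕ} {p : ℕ → Prop}
    (hN : Computes input B N v c) (hc : c ≤ B)
    (he : ∀ i < c, Computes input B e (Matrix.vecCons i v) (ind (p i))) :
    Computes input B (N.ex e) v (ind (∃ i < c, p i)) :=
  (all hN hc fun i hi => (he i hi).not).not.of_eq (by push Not; rfl)

theorem div {a b : ℕ} (ha : a ≤ B) (hb : b ≤ B) (hb' : 0 < b) :
    Computes input B .div ![a, b] (a / b) := by
  refine (count (p := fun q => (q + 1) * b ≤ a) (.var rfl) ha fun i _ =>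
    le (comp₂ (mul hb) ((var rfl).add (const 1)) (var rfl)) (var rfl)).of_eq ?_
  have h : ∀ i, (i + 1) * b ≤ a ↔ i < a / b := fun i => by
    rw [Nat.lt_iff_add_one_le, Nat.le_div_iff_mul_le hb']
  simp only [h]
  rw [Nat.count_eq_card_filter_range]
  have : (Finset.range a).filter (fun i => i < a / b) = Finset.range (a / b) := by
    ext i
    have := Nat.div_le_self a b
    simp only [Finset.mem_filter, Finset.mem_range]
    omega
  exact (congrArg Finset.card this).trans (Finset.card_range _)

theorem mod {a b : ℕ} (ha : a ≤ B) (hb : b ≤ B) (hb' : 0 < b) :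
    Computes input B .mod ![a, b] (a % b) :=
  ((var rfl).sub (comp₂ (mul hb) (div ha hb hb') (var rfl))).of_eq (by
    have := Nat.div_add_mod' a b; simp; omega)

end Computes

end RAM

/-! ### Enumeration of the maps to kept vertices -/

namespace Delegation

/-- Row-major order: entry `i * n + j` of a concatenation of rows of length `n`. -/
theorem getElem?_flatMap_of_length {α β : Type*} {f : α → List β} {n : ℕ} :
    ∀ (l : List α), (∀ a ∈ l, (f a).length = n) → ∀ {i j : ℕ} (hi : i < l.length), j < n →
      (l.flatMap f)[i * n + j]? = (f l[i])[j]?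
  | [], _, i, j, hi, _ => absurd hi (Nat.not_lt_zero i)
  | a :: l, h, 0, j, _, hj => by
    have ha := h a (by simp)
    rw [List.flatMap_cons, List.getElem?_append_left (by omega)]
    simp
  | a :: l, h, i + 1, j, hi, hj => by
    have ha := h a (by simp)
    rw [List.flatMap_cons, List.getElem?_append_right (by rw [ha, Nat.succ_mul]; omega), ha,
      show (i + 1) * n + j - n = i * n + j by rw [Nat.succ_mul]; omega,
      getElem?_flatMap_of_length l (fun b hb => h b (by simp [hb]))
        (Nat.lt_of_succ_lt_succ hi) hj]
    rfl

namespace Instance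

open Classical

variable (x : Instance)

/-- Adjacency in terms of the numbers of the vertices, which is what the machine works with. The
following definitions are the corresponding versions of sinks, twins and kept vertices. -/
def Edge (u v : ℕ) : Prop := ∃ (hu : u < x.n) (hv : v < x.n), x.graph.Adj ⟨u, hu⟩ ⟨v, hv⟩

def Sink (u : ℕ) : Prop := ∀ v < x.n, ¬ x.Edge u v

def Twin (s t : ℕ) : Prop := ∀ u < x.n, (x.Edge u s ↔ x.Edge u t)

/-- The number of non-sinks below `v`. -/
noncomputable def index (v : ℕ) : ℕ := Nat.count (fun u => ¬ x.Sink u) v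

noncomputable def rank (t : ℕ) : ℕ := Nat.count (fun s => x.Sink s ∧ x.Twin s t) t

def IsKept (t : ℕ) : Prop := ¬ x.Sink t ∨ x.rank t < x.index x.n

/-- The number of kept vertices below `v`. At `n` it is the number of all kept vertices, which is
the base of the number system that encodes maps. -/
noncomputable def keptIndex (v : ℕ) : ℕ := Nat.count x.IsKept v

/-- The kept vertex below the second argument that has exactly `j` kept vertices below itself
(`0` if there is none). -/
noncomputable def nthKeptBelow (j : ℕ) : ℕ → ℕ
  | 0 => 0
  | i + 1 => if x.IsKept i ∧ x.keptIndex i = j then i else nthKeptBelow j i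

/-- The map with the code `c`: a sink is fixed, and the non-sink with index `i` is sent to the kept
vertex whose index is the digit of `c` at position `i`. -/
noncomputable def target (c v : ℕ) : ℕ :=
  if x.Sink v then v else
    x.nthKeptBelow (c / x.keptIndex x.n ^ x.index v % x.keptIndex x.n) x.n

/-- The test that the search applies to the code `c`: the map respects the edges, no sink is the
end of too many walks, and, if `acyclic` holds, all walks end in sinks. -/
def Accepts (acyclic : Prop) (c : ℕ) : Prop :=
  ((∀ v < x.n, x.Sink v ∨ x.Edge v (x.target c v)) ∧
    ∀ t < x.n, ¬ x.Sink t ∨ Nat.count (fun v => (x.target c)^[x.n] v = t) x.n ≤ x.lam.toNat) ∧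
    (acyclic → ∀ v < x.n, x.Sink ((x.target c)^[x.n] v))

variable {x}

theorem edge_iff {u v : Fin x.n} : x.Edge u v ↔ x.graph.Adj u v :=
  ⟨fun ⟨_, _, h⟩ => h, fun h => ⟨u.2, v.2, h⟩⟩

theorem sink_iff {u : Fin x.n} : x.Sink u ↔ IsSink x.graph u :=
  ⟨fun h v hv => h v v.2 (edge_iff.2 hv), fun h v hv he => h ⟨v, hv⟩ (edge_iff.1 he)⟩

theorem count_eq_ncard {n : ℕ} (p : ℕ → Prop) [DecidablePred p] :
    Nat.count p n = {v : Fin n | p v}.ncard := by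
  rw [Nat.count_eq_card_filter_range, ← Set.ncard_coe_finset,
    ← Set.ncard_image_of_injective _ Fin.val_injective]
  congr 1
  ext i
  simp only [Finset.coe_filter, Finset.mem_range, Set.mem_image, Set.mem_ofPred_eq]
  exact ⟨fun h => ⟨⟨i, h.1⟩, h.2, rfl⟩, fun ⟨j, hj, e⟩ => e ▸ ⟨j.2, hj⟩⟩

theorem index_n : x.index x.n = x.nonSinks := by
  simp [index, nonSinks, count_eq_ncard, sink_iff]

theorem rank_eq (t : Fin x.n) : x.rank t = (smallerTwins x.graph t).ncard := by
  have ht : {s : ℕ | s < t ∧ x.Sink s ∧ x.Twin s t} = Fin.val '' smallerTwins x.graph t := by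
    ext s
    constructor
    · rintro ⟨h, hs, ht⟩
      lift s to Fin x.n using h.trans t.2
      exact ⟨s, ⟨h, sink_iff.1 hs, fun u => by simpa [edge_iff] using ht u u.2⟩, rfl⟩
    · rintro ⟨s, ⟨h, hs, ht⟩, rfl⟩
      refine ⟨h, sink_iff.2 hs, fun u hu => ?_⟩
      lift u to Fin x.n using hu
      simpa [edge_iff] using ht u
  rw [rank, Nat.count_eq_card_filter_range, ← Set.ncard_image_of_injective _ Fin.val_injective,
    ← ht, ← Set.ncard_coe_finset]
  congr 1
  ext s
  simp

theorem isKept_iff {t : Fin x.n} : x.IsKept t ↔ Kept x.graph t := by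
  rw [IsKept, index_n, rank_eq, sink_iff, Kept, nonSinks]
  exact (imp_iff_not_or).symm

theorem keptIndex_n_le : x.keptIndex x.n ≤ x.nonSinks + x.nonSinks * 2 ^ x.nonSinks := by
  have := ncard_kept_le x.graph
  simpa only [keptIndex, count_eq_ncard, isKept_iff, nonSinks] using this

theorem keptIndex_le : x.keptIndex x.n ≤ x.n := Nat.count_le _

theorem nthKeptBelow_lt {j : ℕ} (i : ℕ) (hi : 0 < i) : x.nthKeptBelow j i < i := by
  induction i with
  | zero => exact absurd hi (lt_irrefl 0)
  | succ i ih =>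
    rw [nthKeptBelow]
    split_ifs
    · exact Nat.lt_succ_self i
    · rcases Nat.eq_zero_or_pos i with rfl | h
      · simp [nthKeptBelow]
      · exact (ih h).trans (Nat.lt_succ_self i)

theorem nthKeptBelow_keptIndex {w i : ℕ} (hw : x.IsKept w) (hi : w < i) :
    x.nthKeptBelow (x.keptIndex w) i = w := by
  induction i with
  | zero => exact absurd hi (Nat.not_lt_zero w)
  | succ i ih =>
    rw [nthKeptBelow]
    split_ifs with h
    · exact Nat.count_injective h.1 hw h.2
    · refine ih (lt_of_le_of_ne (Nat.lt_succ_iff.1 hi) ?_)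
      rintro rfl
      exact h ⟨hw, rfl⟩

theorem target_lt (c : ℕ) {v : ℕ} (hv : v < x.n) : x.target c v < x.n := by
  rw [target]
  split_ifs
  · exact hv
  · exact nthKeptBelow_lt _ (by omega)

theorem iterate_target_lt (c N : ℕ) {v : ℕ} (hv : v < x.n) : (x.target c)^[N] v < x.n := by
  induction N with
  | zero => exact hv
  | succ N ih => rw [Function.iterate_succ_apply']; exact target_lt c ih

variable (x) in
/-- The map with the code `c`, on the vertices of the graph. -/
noncomputable def targetFin (c : ℕ) (v : Fin x.n) : Fin x.n := ⟨x.target c v, target_lt c v.2⟩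

theorem val_iterate_targetFin (c N : ℕ) (v : Fin x.n) :
    ((x.targetFin c)^[N] v : ℕ) = (x.target c)^[N] v := by
  induction N with
  | zero => rfl
  | succ N ih => rw [Function.iterate_succ_apply', Function.iterate_succ_apply', ← ih]; rfl

theorem accepts_iff {acyclic : Prop} {c : ℕ} :
    x.Accepts acyclic c ↔ IsGoodChoice acyclic x.graph x.lam.toNat (x.targetFin c) := by
  have hcount : ∀ t : Fin x.n, Nat.count (fun v => (x.target c)^[x.n] v = t) x.n =
      {v | (x.targetFin c)^[Fintype.card (Fin x.n)] v = t}.ncard := fun t => by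
    simp [count_eq_ncard, ← val_iterate_targetFin, Fin.ext_iff]
  constructor
  · rintro ⟨⟨h₁, h₂⟩, h₃⟩
    refine ⟨⟨fun v hv => ?_, fun v hv => ?_⟩, fun t ht => ?_, fun h v => ?_⟩
    · exact Fin.ext (if_pos (sink_iff.2 hv))
    · exact edge_iff.1 ((h₁ v v.2).resolve_left fun h => hv (sink_iff.1 h))
    · rw [← hcount]
      exact (h₂ t t.2).resolve_left fun h => h (sink_iff.2 ht)
    · rw [← sink_iff, val_iterate_targetFin, Fintype.card_fin]
      exact h₃ h v v.2
  · rintro ⟨⟨h₁, h₂⟩, h₃, h₄⟩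
    refine ⟨⟨fun v hv => ?_, fun t ht => ?_⟩, fun h v hv => ?_⟩
    · lift v to Fin x.n using hv
      exact or_iff_not_imp_left.2 fun h => edge_iff.2 (h₂ v fun h' => h (sink_iff.2 h'))
    · lift t to Fin x.n using ht
      rw [← imp_iff_not_or, hcount]
      exact fun h => h₃ t (sink_iff.1 h)
    · lift v to Fin x.n using hv
      rw [← val_iterate_targetFin, sink_iff]
      simpa using h₄ h v

theorem exists_digits {m : ℕ} (K : ℕ) (δ : ℕ → ℕ) (hδ : ∀ i < K, δ i < m) :
    ∃ c < m ^ K, ∀ i < K, c / m ^ i % m = δ i := by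
  induction K generalizing δ with
  | zero => exact ⟨0, by simp, fun i hi => absurd hi (Nat.not_lt_zero i)⟩
  | succ K ih =>
    obtain ⟨c, hc, h⟩ := ih (fun i => δ (i + 1)) fun i hi => hδ _ (Nat.succ_lt_succ hi)
    have h₀ := hδ 0 K.succ_pos
    have hm : 0 < m := by omega
    refine ⟨δ 0 + m * c, ?_, fun i hi => ?_⟩
    · calc δ 0 + m * c < m + m * c := by omega
        _ = m * (c + 1) := by ring
        _ ≤ m * m ^ K := Nat.mul_le_mul_left _ hc
        _ = m ^ (K + 1) := by ring
    · cases i with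
      | zero => simp [Nat.mod_eq_of_lt h₀]
      | succ i =>
        rw [pow_succ', ← Nat.div_div_eq_div_mul, Nat.add_mul_div_left _ _ hm,
          Nat.div_eq_of_lt h₀, zero_add]
        exact h i (by omega)

/-- Every map to kept vertices has a code. -/
theorem exists_targetFin_eq {g : Fin x.n → Fin x.n} (hg : IsChoice x.graph g)
    (hk : ∀ v, ¬ IsSink x.graph v → Kept x.graph (g v)) :
    ∃ c < x.keptIndex x.n ^ x.nonSinks, x.targetFin c = g := by
  set δ : ℕ → ℕ := fun i =>
    if h : Nat.nth (fun u => ¬ x.Sink u) i < x.n ∧ ¬ x.Sink (Nat.nth (fun u => ¬ x.Sink u) i) then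
      x.keptIndex (g ⟨_, h.1⟩) else 0 with hδ
  have hlt : ∀ i < x.nonSinks, δ i < x.keptIndex x.n := by
    intro i hi
    simp only [hδ]
    split_ifs with h
    · refine Nat.count_strict_mono (isKept_iff.2 (hk _ fun h' => ?_)) (Fin.is_lt _)
      exact h.2 (sink_iff.2 h')
    · -- There is a kept vertex, because there is a non-sink.
      rw [← index_n] at hi
      obtain ⟨u, hu, hu'⟩ := Nat.count_ne_iff_exists.1 (Nat.ne_of_gt (Nat.zero_lt_of_lt hi))
      exact Nat.pos_of_ne_zero (Nat.count_ne_iff_exists.2 ⟨u, hu, .inl hu'⟩)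
  obtain ⟨c, hc, h⟩ := exists_digits x.nonSinks δ hlt
  refine ⟨c, hc, funext fun v => Fin.ext ?_⟩
  by_cases hv : x.Sink v
  · rw [hg.sink v (sink_iff.1 hv)]
    exact if_pos hv
  · have hnth : Nat.nth (fun u => ¬ x.Sink u) (x.index v) = v :=
      Nat.nth_count (p := fun u => ¬ x.Sink u) hv
    have hi : x.index v < x.nonSinks := by
      rw [← index_n]
      exact Nat.count_strict_mono (p := fun u => ¬ x.Sink u) hv v.2
    have h' := h _ hi
    simp only [hδ, hnth, hv, v.2, not_false_eq_true, and_self, dif_pos] at h'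
    change x.target c v = _
    rw [target, if_neg hv, h']
    exact nthKeptBelow_keptIndex (isKept_iff.2 (hk v fun h => hv (sink_iff.2 h))) (g v).2
theorem exists_isSolution_iff_exists_accepts (acyclic : Prop) :
    (∃ H, IsSolution x.graph x.lam H ∧ (acyclic → Acyclic H)) ↔
      ∃ c < x.keptIndex x.n ^ x.nonSinks, x.Accepts acyclic c := by
  rw [exists_isSolution_iff]
  constructor
  · rintro ⟨g, hg⟩
    obtain ⟨g, hg, hk⟩ := hg.exists_kept
    obtain ⟨c, hc, rfl⟩ := exists_targetFin_eq hg.toIsChoice hk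
    exact ⟨c, hc, accepts_iff.2 hg⟩
  · rintro ⟨c, -, hc⟩
    exact ⟨_, accepts_iff.1 hc⟩

end Instance

end Delegation

/-! ### The search as an expression -/

namespace Delegation

namespace Instance

open Classical

variable (x : Instance)

theorem encode_getD_add_three (i : ℕ) : x.encode.getD (i + 3) 0 =
    ((List.finRange x.n).flatMap fun u => (List.finRange x.n).map fun v =>
      RAM.ind (x.graph.Adj u v)).getD i 0 := by
  rfl

theorem encode_edge {u v : ℕ} (hu : u < x.n) (hv : v < x.n) :
    x.encode.getD (3 + (u * x.n + v)) 0 = RAM.ind (x.Edge u v) := by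
  rw [add_comm 3, encode_getD_add_three, List.getD_eq_getElem?_getD,
    getElem?_flatMap_of_length _ (by simp) (by simpa using hu) hv]
  have h : x.Edge u v ↔ x.graph.Adj ⟨u, hu⟩ ⟨v, hv⟩ := edge_iff (u := ⟨u, hu⟩) (v := ⟨v, hv⟩)
  simp [hv, h]

end Instance

end Delegation

namespace RAM

namespace LoopExpr

variable {n : ℕ}

/-! The following expressions compute the notions of the same names in `Delegation.Instance`. Their
arguments are the variables, in the same order. -/

/-- The number of vertices, which is the first entry of the input. -/
def size : LoopExpr n := read (const 0)

def edge : LoopExpr 2 := read (add (const 3) (add (comp₂ mul (var 0) size) (var 1)))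

def sink : LoopExpr 1 := all size (not (comp₂ edge (var 1) (var 0)))

def index : LoopExpr 1 := count (var 0) (not (comp₁ sink (var 0)))

def twin : LoopExpr 2 :=
  all size (eq (comp₂ edge (var 0) (var 1)) (comp₂ edge (var 0) (var 2)))

def rank : LoopExpr 1 := count (var 0) (and (comp₁ sink (var 0)) (comp₂ twin (var 0) (var 1)))

def kept : LoopExpr 1 := or (not sink) (lt rank (comp₁ index size))

def keptIndex : LoopExpr 1 := count (var 0) (comp₁ kept (var 0))

def nthKept : LoopExpr 1 :=
  fold size (const 0)
    (ite (and (comp₁ kept (var 0)) (eq (comp₁ keptIndex (var 0)) (var 2))) (var 0) (var 1))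

/-- The digit of the code (variable `0`) at the position given by variable `1`. -/
def digit : LoopExpr 2 :=
  comp₂ mod (fold (var 1) (var 0) (comp₂ div (var 1) (comp₁ keptIndex size)))
    (comp₁ keptIndex size)

/-- Only the positive branch of `ite` is evaluated conditionally. It has to be the one for
non-sinks, as the base of the number system can be `0` if all vertices are sinks. -/
def target : LoopExpr 2 :=
  ite (not (comp₁ sink (var 1))) (comp₁ nthKept (comp₂ digit (var 0) (comp₁ index (var 1)))) (var 1)

/-- The end of the walk of length `n` from variable `1` along the map with the code in
variable `0`. -/
def endpoint : LoopExpr 2 := fold size (var 1) (comp₂ target (var 2) (var 1))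

/-- The entry with index `1` of the input is `max λ 0`. -/
def accepts (acyclic : Bool) : LoopExpr 1 :=
  and (and (all size (or (comp₁ sink (var 0)) (comp₂ edge (var 0) (comp₂ target (var 1) (var 0)))))
      (all size (or (not (comp₁ sink (var 0)))
        (le (count size (eq (comp₂ endpoint (var 2) (var 0)) (var 1))) (read (const 1))))))
    (if acyclic then all size (comp₁ sink (comp₂ endpoint (var 1) (var 0))) else const 1)

/-- The search through all codes below `m ^ k`, where `m` is the number of kept vertices. -/
def resolve (acyclic : Bool) : LoopExpr 0 :=
  ex (fold (comp₁ index size) (const 1) (comp₂ mul (var 1) (comp₁ keptIndex size)))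
    (accepts acyclic)

end LoopExpr

namespace Computes

open Delegation Delegation.Instance Classical

variable {x : Instance} {B n : ℕ} {v : Fin n → ℕ}

theorem size : Computes x.encode B .size v x.n := (const 0).read

theorem edge (hB : x.n ≤ B) {u v : ℕ} (hu : u < x.n) (hv : v < x.n) :
    Computes x.encode B .edge ![u, v] (ind (x.Edge u v)) :=
  (read (a := 3 + (u * x.n + v))
    (add (const 3) (add (comp₂ (mul hB) (var rfl) size) (var rfl)))).of_eq (x.encode_edge hu hv)

theorem sink (hB : x.n ≤ B) {u : ℕ} (hu : u < x.n) :
    Computes x.encode B .sink ![u] (ind (x.Sink u)) :=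
  all size hB fun _ hv => not (comp₂ (edge hB hu hv) (var rfl) (var rfl))

theorem index (hB : x.n ≤ B) {u : ℕ} (hu : u ≤ x.n) :
    Computes x.encode B .index ![u] (x.index u) :=
  count (var rfl) (hu.trans hB) fun _ hv =>
    not (comp₁ (sink hB (lt_of_lt_of_le hv hu)) (var rfl))

theorem twin (hB : x.n ≤ B) {s t : ℕ} (hs : s < x.n) (ht : t < x.n) :
    Computes x.encode B .twin ![s, t] (ind (x.Twin s t)) := by
  have h : x.Twin s t ↔ ∀ u < x.n, ind (x.Edge u s) = ind (x.Edge u t) :=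
    forall₂_congr fun u _ => by
      by_cases h₁ : x.Edge u s <;> by_cases h₂ : x.Edge u t <;> simp [ind, h₁, h₂]
  rw [h]
  exact all size hB fun u hu => eq (comp₂ (edge hB hu hs) (var rfl) (var rfl))
    (comp₂ (edge hB hu ht) (var rfl) (var rfl))

theorem rank (hB : x.n ≤ B) {t : ℕ} (ht : t < x.n) :
    Computes x.encode B .rank ![t] (x.rank t) :=
  count (var rfl) (ht.le.trans hB) fun _ hs => and (comp₁ (sink hB (hs.trans ht)) (var rfl))
    (comp₂ (twin hB (hs.trans ht) ht) (var rfl) (var rfl))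

theorem kept (hB : x.n ≤ B) {t : ℕ} (ht : t < x.n) :
    Computes x.encode B .kept ![t] (ind (x.IsKept t)) :=
  or (not (sink hB ht)) (lt (rank hB ht) (comp₁ (index hB le_rfl) size))

theorem keptIndex (hB : x.n ≤ B) {t : ℕ} (ht : t ≤ x.n) :
    Computes x.encode B .keptIndex ![t] (x.keptIndex t) :=
  count (var rfl) (ht.trans hB) fun _ hs =>
    comp₁ (kept hB (lt_of_lt_of_le hs ht)) (var rfl)

theorem nthKept (hB : x.n ≤ B) (j : ℕ) :
    Computes x.encode B .nthKept ![j] (x.nthKeptBelow j x.n) := by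
  refine fold _ size hB (const 0) fun i hi => ?_
  have hp : Computes x.encode B (.and (.comp₁ .kept (.var 0)) (.eq (.comp₁ .keptIndex (.var 0))
      (.var 2))) ![i, x.nthKeptBelow j i, j] (ind (x.IsKept i ∧ x.keptIndex i = j)) :=
    and (comp₁ (kept hB hi) (var rfl)) (eq (comp₁ (keptIndex hB hi.le) (var rfl)) (var rfl))
  rw [nthKeptBelow]
  split_ifs with h
  · exact ite_of_pos (by omega) hp h (var rfl) (var rfl)
  · exact ite_of_neg hp h (var rfl)

theorem digit (hB : x.n ≤ B) {c i : ℕ} (hc : c ≤ B) (hi : i ≤ B) (hm : 0 < x.keptIndex x.n) :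
    Computes x.encode B .digit ![c, i] (c / x.keptIndex x.n ^ i % x.keptIndex x.n) := by
  have hm' := keptIndex_le.trans hB
  refine comp₂ (mod ((Nat.div_le_self _ _).trans hc) hm' hm)
    (fold (fun i => c / x.keptIndex x.n ^ i) (var rfl) hi (var (by simp)) fun j _ => ?_)
    (comp₁ (keptIndex hB le_rfl) size)
  rw [pow_succ, ← Nat.div_div_eq_div_mul]
  exact comp₂ (div ((Nat.div_le_self _ _).trans hc) hm' hm) (var rfl)
    (comp₁ (keptIndex hB le_rfl) size)

theorem target (hB : x.n ≤ B) {c v : ℕ} (hc : c ≤ B) (hv : v < x.n) :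
    Computes x.encode B .target ![c, v] (x.target c v) := by
  have hs := not (comp₁ (sink hB hv) (e := .var 1) (v := ![c, v]) (var rfl))
  rw [Instance.target]
  split_ifs with h
  · exact ite_of_neg hs (not_not.2 h) (var rfl)
  · refine ite_of_pos (by omega) hs h (comp₁ (nthKept hB _) (comp₂ (digit hB hc ?_ ?_) (var rfl)
      (comp₁ (index hB hv.le) (var rfl)))) (var rfl)
    · exact (Nat.count_le _).trans (hv.le.trans hB)
    · exact Nat.pos_of_ne_zero (Nat.count_ne_iff_exists.2 ⟨v, hv, .inl h⟩)

theorem endpoint (hB : x.n ≤ B) {c v : ℕ} (hc : c ≤ B) (hv : v < x.n) :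
    Computes x.encode B .endpoint ![c, v] ((x.target c)^[x.n] v) := by
  refine fold (fun i => (x.target c)^[i] v) size hB (var rfl) fun i _ => ?_
  rw [Function.iterate_succ_apply']
  exact comp₂ (target hB hc (iterate_target_lt c i hv)) (var rfl) (var rfl)

theorem accepts (hB : x.n ≤ B) {c : ℕ} (hc : c ≤ B) (acyclic : Bool) :
    Computes x.encode B (.accepts acyclic) ![c] (ind (x.Accepts acyclic c)) := by
  refine and (and (all size hB fun v hv => ?_) (all size hB fun t ht => ?_)) ?_
  · exact or (comp₁ (sink hB hv) (var rfl)) (comp₂ (edge hB hv (target_lt c hv)) (var rfl)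
      (comp₂ (target hB hc hv) (var rfl) (var rfl)))
  · exact or (not (comp₁ (sink hB ht) (var rfl))) (le (count size hB fun v hv =>
      eq (comp₂ (endpoint hB hc hv) (var rfl) (var rfl)) (var rfl)) (const 1).read)
  · cases acyclic with
    | false => exact (const 1).of_eq (ind_eq_one (by simp)).symm
    | true =>
      simp only [if_true, forall_const]
      exact all size hB fun v hv => comp₁ (sink hB (iterate_target_lt c _ hv))
        (comp₂ (endpoint hB hc hv) (var rfl) (var rfl))

theorem resolve (hB : x.n ≤ B) (hB' : x.keptIndex x.n ^ x.nonSinks ≤ B) (acyclic : Bool) :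
    Computes x.encode B (.resolve acyclic) ![]
      (ind (∃ H, IsSolution x.graph x.lam H ∧ (acyclic → Acyclic H))) := by
  rw [exists_isSolution_iff_exists_accepts, ← index_n] at *
  refine ex (fold (fun i => x.keptIndex x.n ^ i) (comp₁ (index hB le_rfl) size)
    ((Nat.count_le _).trans hB) (const 1) fun i _ => ?_) hB' fun c hc =>
      accepts hB (hc.le.trans hB') acyclic
  rw [pow_succ]
  exact comp₂ (mul (keptIndex_le.trans hB)) (var rfl) (comp₁ (keptIndex hB le_rfl) size)

end Computes

end RAM

open Delegation in
theorem fixedParameterTractable_of_iff_exists_isSolution (acyclic : Bool) {yes : Instance → Prop}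
    (h : ∀ x, yes x ↔ ∃ H, IsSolution x.graph x.lam H ∧ (acyclic → Acyclic H)) :
    FixedParameterTractable Instance.encode Instance.size Instance.nonSinks yes := by
  rw [show yes = _ from funext fun x => propext (h x)]
  refine fixedParameterTractable_of_computes (.resolve acyclic)
    (fun k => (k + k * 2 ^ k) ^ k) ?_ fun x => .resolve (Nat.le_add_right _ _) ?_ acyclic
  · have hpow : Primrec₂ fun a b : ℕ => a ^ b := Primrec₂.unpaired'.1 Nat.Primrec.pow
    exact (hpow.comp (Primrec.nat_add.comp .id (Primrec.nat_mul.comp .id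
      (hpow.comp (.const 2) .id))) .id).to_comp
  · exact (Nat.pow_le_pow_left Instance.keptIndex_n_le _).trans (Nat.le_add_left _ _)

theorem theorem4 :
    FixedParameterTractable Delegation.Instance.encode Delegation.Instance.size
      Delegation.Instance.nonSinks Delegation.Instance.Resolvable ∧
    FixedParameterTractable Delegation.Instance.encode Delegation.Instance.size
      Delegation.Instance.nonSinks Delegation.Instance.ResolvableWithCycles := by
  constructor
  · refine fixedParameterTractable_of_iff_exists_isSolution true fun x => ?_
    simp [Delegation.Instance.Resolvable]
  · refine fixedParameterTractable_of_iff_exists_isSolution false fun x => ?_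
    simp [Delegation.Instance.ResolvableWithCycles]
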